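/- Let $K,N_T,N_R\ge 1$ be integers, $R>0$ and $\gamma_1,\dots,\gamma_K>0$. For $k=1,\dots,K$ let $\mathbf u_k\sim\mathcal{CN}(\mathbf 0,\mathbf I_{N_R})$ and $\mathbf v_k\sim\mathcal{CN}(\mathbf 0,\mathbf I_{N_T})$ be independent complex Gaussian random vectors (the entries are i.i.d., and the real and imaginary parts of each entry are independent $\mathcal N(0,\tfrac12)$), let $\mathbf H_k=\mathbf u_k\mathbf v_k^{\mathrm H}$ be the rank-one keyhole channel matrix of the $k$-th round, and assume that $\mathbf H_1,\dots,\mathbf H_K$ are independent. Then the outage probability of Type-I HARQ at rate $R$ is $$ \Pr\Big(\max_{1\le k\le K}\log_2\det\Big(\mathbf I_{N_R}+\frac{\gamma_k}{N_T}\mathbf H_k\mathbf H_k^{\mathrm H}\Big)<R\Big) =\frac{1}{\big(\Gamma(N_T)\Gamma(N_R)\big)^{K}}\prod_{k=1}^{K} G^{2,1}_{1,3}\!\left(\left.\begin{matrix}1\\ N_T,\,N_R,\,0\end{matrix}\,\right|\,\frac{N_T}{\gamma_k}\,(2^R-1)\right). $$ Here $G^{m,n}_{p,q}$ is Meijer's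 G-function, $$ G^{m,n}_{p,q}\!\left(\left.\begin{matrix}a_1,\dots,a_p\\ b_1,\dots,b_q\end{matrix}\,\right|\,z\right) =\frac1{2\pi i}\int_{c-i\infty}^{c+i\infty} \frac{\prod_{j=1}^m\Gamma(b_j-s)\,\prod_{j=1}^n\Gamma(1-a_j+s)}{\prod_{j=m+1}^q\Gamma(1-b_j+s)\,\prod_{j=n+1}^p\Gamma(a_j-s)}\,z^s\,ds , $$ where the line $\operatorname{Re}s=c$ has the poles of $\Gamma(b_j-s)$, $j\le m$, on its right and the poles of $\Gamma(1-a_j+s)$, $j\le n$, on its left. For the parameters and arguments above such lines exist (those with $0<c<\min(N_T,N_R)$), and along each of them the integral converges absolutely and has the same value. -/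

import Mathlib

open MeasureTheory ProbabilityTheory

noncomputable section

/-! ### Meijer's G-function -/

/-- The Mellin-Barnes integrand of `G^{m,n}_{p,q}(a; b | z)`, namely
`∏_{j ≤ m} Γ(b_j - s) ∏_{j ≤ n} Γ(1 - a_j + s) /
  (∏_{m < j ≤ q} Γ(1 - b_j + s) ∏_{n < j ≤ p} Γ(a_j - s)) * z ^ s`.
(The index `j : Fin q` stands for the parameter number `j + 1`. The reciprocal Gamma function
takes the value `0` at the poles of `Γ`, which is also what `(Complex.Gamma _)⁻¹` gives.) -/
def meijerGIntegrand (m n : ℕ) {p q : ℕ} (a : Fin p → ℂ) (b : Fin q → ℂ) (z s : ℂ) : ℂ :=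
  (∏ j : Fin q, if (j : ℕ) < m then Complex.Gamma (b j - s) else (Complex.Gamma (1 - b j + s))⁻¹) *
  (∏ j : Fin p, if (j : ℕ) < n then Complex.Gamma (1 - a j + s) else (Complex.Gamma (a j - s))⁻¹) *
  z ^ s

/-- The vertical line `Re s = c` separates the poles of the integrand: those of `Γ(b_j - s)`,
`j ≤ m`, i.e. the points `b_j + k`, lie to its right and those of `Γ(1 - a_j + s)`, `j ≤ n`,
i.e. the points `a_j - 1 - k`, lie to its left (`k = 0, 1, 2, …`). -/
def MeijerGSeparates (m n : ℕ) {p q : ℕ} (a : Fin p → ℂ) (b : Fin q → ℂ) (c : ℝ) : Prop :=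
  (∀ j : Fin q, (j : ℕ) < m → ∀ k : ℕ, c < (b j + k).re) ∧
  (∀ j : Fin p, (j : ℕ) < n → ∀ k : ℕ, (a j - 1 - k).re < c)

/-- `1 / (2 π i) ∫_{c - i ∞}^{c + i ∞}` of the integrand, with the line parametrised as
`s = c + i t`, `ds = i dt`. -/
def meijerGLine (m n : ℕ) {p q : ℕ} (a : Fin p → ℂ) (b : Fin q → ℂ) (c : ℝ) (z : ℂ) : ℂ :=
  (2 * (Real.pi : ℂ))⁻¹ * ∫ t : ℝ, meijerGIntegrand m n a b z ((c : ℂ) + (t : ℂ) * Complex.I)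

open Classical in
/-- Meijer's G-function `G^{m,n}_{p,q}(a; b | z)`, for parameters whose two families of poles can be
separated by a vertical line: the Mellin-Barnes integral along such a line. That it does not matter
which separating line is taken, and that the integral converges, is `MeijerGWellDefined`. -/
def meijerG (m n : ℕ) {p q : ℕ} (a : Fin p → ℂ) (b : Fin q → ℂ) (z : ℂ) : ℂ :=
  if h : ∃ c : ℝ, MeijerGSeparates m n a b c then meijerGLine m n a b h.choose z else 0

/-- There is a separating vertical line, and along every such line the Mellin-Barnes integral
converges absolutely and has the value `meijerG m n a b z`. -/
def MeijerGWellDefined (m n : ℕ) {p q : ℕ} (a : Fin p → ℂ) (b : Fin q → ℂ) (z : ℂ) : Prop :=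
  (∃ c : ℝ, MeijerGSeparates m n a b c) ∧
  ∀ c : ℝ, MeijerGSeparates m n a b c →
    Integrable (fun t : ℝ => meijerGIntegrand m n a b z ((c : ℂ) + (t : ℂ) * Complex.I)) ∧
    meijerGLine m n a b c z = meijerG m n a b z

/-! ### Keyhole channels -/

/-- The law `CN(0, 1)` on `ℂ`: real and imaginary part are independent, each `N(0, 1/2)`. -/
def complexGaussian : Measure ℂ :=
  ((gaussianReal 0 (1 / 2)).prod (gaussianReal 0 (1 / 2))).map
    (fun x : ℝ × ℝ => (x.1 : ℂ) + (x.2 : ℂ) * Complex.I)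

/-- The law `CN(0, I_N)` on `ℂ^N`: the coordinates are i.i.d. `CN(0, 1)`. -/
def complexGaussianVector (N : ℕ) : Measure (Fin N → ℂ) :=
  Measure.pi (fun _ => complexGaussian)

/-- Matrices carry the product σ-algebra of their entries. -/
instance matrixMeasurableSpace {m n : Type*} : MeasurableSpace (Matrix m n ℂ) :=
  inferInstanceAs (MeasurableSpace (m → n → ℂ))

/-- The keyhole channel matrix `u vᴴ`, with entries `u_i * conj v_j`. -/
def keyholeChannel {NR NT : ℕ} (u : Fin NR → ℂ) (v : Fin NT → ℂ) : Matrix (Fin NR) (Fin NT) ℂ :=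
  Matrix.vecMulVec u (star v)

/-- The mutual information `log₂ det (I + (γ / N_T) H Hᴴ)` of one round. (The matrix is Hermitian,
so its determinant is a real number.) -/
def mutualInfo {NR NT : ℕ} (γ : ℝ) (H : Matrix (Fin NR) (Fin NT) ℂ) : ℝ :=
  Real.logb 2 (1 + ((γ / NT : ℝ) : ℂ) • (H * H.conjTranspose)).det.re

/-- The accumulated mutual information of Type-I HARQ after `K ≥ 1` rounds: the maximum over the
rounds. -/
def typeIMutualInfo {K NR NT : ℕ} [NeZero K] (γ : Fin K → ℝ)
    (H : Fin K → Matrix (Fin NR) (Fin NT) ℂ) : ℝ :=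
  Finset.univ.sup' Finset.univ_nonempty (fun k => mutualInfo (γ k) (H k))

/-- The outage probability: the probability that the accumulated mutual information is less than
the rate `R`. -/
def outageProbability {Ω : Type*} [MeasurableSpace Ω] (P : Measure Ω) {K NR NT : ℕ} [NeZero K]
    (γ : Fin K → ℝ) (H : Fin K → Ω → Matrix (Fin NR) (Fin NT) ℂ) (R : ℝ) : ℝ :=
  P.real {ω | typeIMutualInfo γ (fun k => H k ω) < R}

end

/-!
The matrix `1 + g • H Hᴴ` with `H = u vᴴ` is a rank-one perturbation of the identity, of
determinant `1 + g ‖u‖² ‖v‖²`. So a round is in outage when `‖u‖² ‖v‖²` lies below a threshold, and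
`‖u‖²`, `‖v‖²` are independent Gamma variables of shapes `NR`, `NT`: this is read off from moment
generating functions, since the square of a real Gaussian is a Gamma variable of shape `1 / 2`.

The distribution function of a product of independent Gamma variables has the Mellin transform
`-Γ(a + s) Γ(b + s) / (Γ(a) Γ(b) s)` on `-min a b < Re s < 0`, because moments of an independent
product multiply. The Mellin-Barnes integral is its Mellin inversion at `-s`. It converges
absolutely because `Γ` is square integrable along vertical lines in the right half-plane: there
`|Γ(z)| = |Γ(z + 1)| / |z| ≤ Γ(Re z + 1) / |z|`.
-/

section GammaLaw

variable {a r : ℝ}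

lemma gammaMeasure_eq_withDensity_restrict_Ioi (a r : ℝ) :
    gammaMeasure a r = (volume.restrict (Set.Ioi 0)).withDensity fun x =>
      ENNReal.ofReal (r ^ a / Real.Gamma a * (x ^ (a - 1) * Real.exp (-(r * x)))) := by
  rw [gammaMeasure, ← Measure.restrict_congr_set Ioi_ae_eq_Ici.symm,
    ← withDensity_indicator measurableSet_Ici]
  congr with x
  by_cases hx : 0 ≤ x <;> simp [gammaPDF_eq, hx, mul_assoc]

instance nullSingletonClass_gammaMeasure (a r : ℝ) : NullSingletonClass (gammaMeasure a r) := by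
  unfold gammaMeasure
  infer_instance

lemma ae_pos_gammaMeasure (a r : ℝ) : ∀ᵐ x ∂gammaMeasure a r, 0 < x := by
  rw [gammaMeasure_eq_withDensity_restrict_Ioi]
  exact (withDensity_absolutelyContinuous _ _).ae_le (ae_restrict_mem measurableSet_Ioi)

variable {E : Type*} [NormedAddCommGroup E] [NormedSpace ℝ E]

lemma integral_gammaMeasure (ha : 0 < a) (hr : 0 < r) (f : ℝ → E) :
    ∫ x, f x ∂gammaMeasure a r =
      (r ^ a / Real.Gamma a) • ∫ x in Set.Ioi 0, (x ^ (a - 1) * Real.exp (-(r * x))) • f x := by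
  rw [gammaMeasure_eq_withDensity_restrict_Ioi, integral_withDensity_eq_integral_toReal_smul
    (by fun_prop) (ae_of_all _ fun _ => ENNReal.ofReal_lt_top), ← integral_smul]
  refine setIntegral_congr_fun measurableSet_Ioi fun x (hx : 0 < x) => ?_
  have := Real.Gamma_pos_of_pos ha
  simp only [smul_smul]
  rw [ENNReal.toReal_ofReal (by positivity)]

lemma integrable_gammaMeasure_iff (ha : 0 < a) (hr : 0 < r) {f : ℝ → E} :
    Integrable f (gammaMeasure a r) ↔
      IntegrableOn (fun x => (x ^ (a - 1) * Real.exp (-(r * x))) • f x) (Set.Ioi 0) := by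
  have hC : 0 < r ^ a / Real.Gamma a :=
    div_pos (Real.rpow_pos_of_pos hr a) (Real.Gamma_pos_of_pos ha)
  rw [gammaMeasure_eq_withDensity_restrict_Ioi, integrable_withDensity_iff_integrable_smul'
    (by fun_prop) (ae_of_all _ fun _ => ENNReal.ofReal_lt_top), IntegrableOn,
    ← integrable_smul_iff hC.ne' (fun x : ℝ => (x ^ (a - 1) * Real.exp (-(r * x))) • f x)]
  refine integrable_congr ?_
  filter_upwards [ae_restrict_mem measurableSet_Ioi] with x (hx : 0 < x)
  simp only [Pi.smul_apply, smul_smul]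
  rw [ENNReal.toReal_ofReal (by positivity)]

lemma integrable_rpow_gammaMeasure (ha : 0 < a) (hr : 0 < r) {c : ℝ} (hc : 0 < a + c) :
    Integrable (fun x => x ^ c) (gammaMeasure a r) := by
  rw [integrable_gammaMeasure_iff ha hr]
  have h := integrableOn_rpow_mul_exp_neg_mul_rpow (s := a + c - 1) (p := 1) (b := r)
    (by linarith) one_pos hr
  refine h.congr_fun (fun x (hx : 0 < x) => ?_) measurableSet_Ioi
  simp only [Real.rpow_one, neg_mul, smul_eq_mul]
  rw [mul_right_comm, ← Real.rpow_add hx]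
  ring_nf

lemma integral_cpow_gammaMeasure (ha : 0 < a) (hr : 0 < r) {s : ℂ} (hs : 0 < a + s.re) :
    ∫ x, (x : ℂ) ^ s ∂gammaMeasure a r =
      (r : ℂ) ^ (-s) * (Complex.Gamma (a + s) / Complex.Gamma a) := by
  have h : ∫ x : ℝ in Set.Ioi 0, (x ^ (a - 1) * Real.exp (-(r * x))) • (x : ℂ) ^ s =
      (1 / r : ℂ) ^ (a + s) * Complex.Gamma (a + s) := by
    rw [← Complex.integral_cpow_mul_exp_neg_mul_Ioi (by simpa using hs) hr]
    refine setIntegral_congr_fun measurableSet_Ioi fun x (hx : 0 < x) => ?_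
    have hx0 : (x : ℂ) ≠ 0 := mod_cast hx.ne'
    simp only [Complex.real_smul]
    push_cast [Complex.ofReal_cpow hx.le]
    rw [mul_right_comm, ← Complex.cpow_add _ _ hx0]
    ring_nf
  have hr0 : (r : ℂ) ≠ 0 := mod_cast hr.ne'
  have hinv : (1 / r : ℂ) ^ (a + s) = ((r : ℂ) ^ (a : ℂ))⁻¹ * (r : ℂ) ^ (-s) := by
    have harg : (r : ℂ).arg ≠ Real.pi := by
      simp [Complex.arg_ofReal_of_nonneg hr.le, Real.pi_ne_zero.symm]
    rw [one_div, Complex.inv_cpow _ _ harg, ← Complex.cpow_neg, ← Complex.cpow_neg,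
      ← Complex.cpow_add _ _ hr0, neg_add]
  have hra : (r : ℂ) ^ (a : ℂ) ≠ 0 := by simp [Complex.cpow_eq_zero_iff, hr0]
  rw [integral_gammaMeasure ha hr, h, hinv, Complex.real_smul, Complex.Gamma_ofReal]
  push_cast [Complex.ofReal_cpow hr.le]
  field_simp

lemma not_integrableOn_rpow_mul_exp_neg_mul_Ioi (a : ℝ) {b : ℝ} (hb : b ≤ 0) :
    ¬ IntegrableOn (fun x => x ^ (a - 1) * Real.exp (-(b * x))) (Set.Ioi 0) := by
  intro h
  refine not_integrableOn_Ioi_rpow (a - 1) (h.mono' (by fun_prop) ?_)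
  filter_upwards [ae_restrict_mem measurableSet_Ioi] with x (hx : 0 < x)
  rw [Real.norm_of_nonneg (by positivity)]
  exact le_mul_of_one_le_right (by positivity) (Real.one_le_exp (by nlinarith))

lemma mgf_id_gammaMeasure (ha : 0 < a) (hr : 0 < r) (t : ℝ) :
    mgf id (gammaMeasure a r) t = if t < r then (r / (r - t)) ^ a else 0 := by
  have hexp : (fun x => (x ^ (a - 1) * Real.exp (-(r * x))) • Real.exp (t * x)) =
      fun x => x ^ (a - 1) * Real.exp (-((r - t) * x)) := by
    ext x
    rw [smul_eq_mul, mul_assoc, ← Real.exp_add]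
    ring_nf
  split_ifs with h
  · have := Real.Gamma_pos_of_pos ha
    simp only [mgf, id, integral_gammaMeasure ha hr, hexp]
    rw [Real.integral_rpow_mul_exp_neg_mul_Ioi ha (sub_pos.2 h), smul_eq_mul,
      Real.div_rpow hr.le (sub_pos.2 h).le, Real.div_rpow zero_le_one (sub_pos.2 h).le,
      Real.one_rpow]
    field_simp
  · have hrt : r - t ≤ 0 := sub_nonpos.2 (not_lt.1 h)
    refine mgf_undef fun hI => not_integrableOn_rpow_mul_exp_neg_mul_Ioi a hrt ?_
    rw [← hexp]
    exact (integrable_gammaMeasure_iff ha hr).1 hI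

lemma integrableExpSet_id_gammaMeasure (ha : 0 < a) (hr : 0 < r) :
    integrableExpSet id (gammaMeasure a r) = Set.Iio r := by
  have := isProbabilityMeasure_gammaMeasure ha hr
  ext t
  rw [integrableExpSet, Set.mem_ofPred_eq, ← mgf_pos_iff, mgf_id_gammaMeasure ha hr, Set.mem_Iio]
  split_ifs with h
  · simpa only [h, iff_true] using Real.rpow_pos_of_pos (div_pos hr (sub_pos.2 h)) a
  · simp [h]

variable {Ω : Type*} [MeasurableSpace Ω] {P : Measure Ω} [IsProbabilityMeasure P]

lemma hasLaw_gammaMeasure_iff_mgf (ha : 0 < a) (hr : 0 < r) {X : Ω → ℝ} (hX : AEMeasurable X P) :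
    HasLaw X (gammaMeasure a r) P ↔
      ∀ t, mgf X P t = if t < r then (r / (r - t)) ^ a else 0 := by
  have := isProbabilityMeasure_gammaMeasure ha hr
  have := Measure.isProbabilityMeasure_map hX
  simp only [← mgf_id_gammaMeasure ha hr, ← mgf_id_map hX]
  refine ⟨fun h t => by rw [h.map_eq], fun h => ⟨hX, Measure.ext_of_charFun (funext fun t => ?_)⟩⟩
  rw [← complexMGF_id_mul_I, ← complexMGF_id_mul_I]
  refine (eqOn_complexMGF_of_mgf (funext h).symm ?_).symm
  simpa [integrableExpSet_id_gammaMeasure ha hr, isOpen_Iio.interior_eq] using hr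

lemma hasLaw_add_gammaMeasure {b : ℝ} (ha : 0 < a) (hb : 0 < b) (hr : 0 < r) {X Y : Ω → ℝ}
    (hX : HasLaw X (gammaMeasure a r) P) (hY : HasLaw Y (gammaMeasure b r) P)
    (hXY : IndepFun X Y P) : HasLaw (X + Y) (gammaMeasure (a + b) r) P := by
  have hX' := hX.aemeasurable
  have hY' := hY.aemeasurable
  refine (hasLaw_gammaMeasure_iff_mgf (add_pos ha hb) hr (by fun_prop)).2 fun t => ?_
  rw [hXY.mgf_add' (by fun_prop) (by fun_prop), (hasLaw_gammaMeasure_iff_mgf ha hr hX').1 hX,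
    (hasLaw_gammaMeasure_iff_mgf hb hr hY').1 hY]
  split_ifs with h
  · exact (Real.rpow_add (div_pos hr (sub_pos.2 h)) a b).symm
  · exact mul_zero _

lemma hasLaw_sum_gammaMeasure {ι : Type*} {X : ι → Ω → ℝ} {a : ι → ℝ} (ha : ∀ i, 0 < a i)
    (hr : 0 < r) (hX : ∀ i, HasLaw (X i) (gammaMeasure (a i) r) P) (hind : iIndepFun X P)
    {s : Finset ι} (hs : s.Nonempty) :
    HasLaw (∑ i ∈ s, X i) (gammaMeasure (∑ i ∈ s, a i) r) P := by
  induction hs using Finset.Nonempty.cons_induction with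
  | singleton i => simpa using hX i
  | cons i s his hs ih =>
    rw [Finset.sum_cons, Finset.sum_cons]
    have hindep := hind.indepFun_finsetSum_of_notMem₀ (fun j => (hX j).aemeasurable) his
    exact hasLaw_add_gammaMeasure (ha i) (Finset.sum_pos (fun j _ => ha j) hs) hr (hX i) ih
      hindep.symm

lemma mgf_sq_gaussianReal {v : NNReal} (hv : v ≠ 0) (t : ℝ) :
    mgf (fun x => x ^ 2) (gaussianReal 0 v) t = √(1 / (1 - 2 * v * t)) := by
  have : (0 : ℝ) < v := mod_cast hv.bot_lt
  rw [mgf, integral_gaussianReal_eq_integral_smul hv]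
  have : (fun x => gaussianPDFReal 0 v x • Real.exp (t * x ^ 2)) = fun x =>
    (√(2 * Real.pi * v))⁻¹ * Real.exp (-(1 / (2 * v) - t) * x ^ 2) := by
    ext x
    rw [gaussianPDFReal, smul_eq_mul, mul_assoc, ← Real.exp_add]
    ring_nf
  rw [this, integral_const_mul, integral_gaussian, ← Real.sqrt_inv, ← Real.sqrt_mul (by positivity)]
  congr 1
  field_simp

lemma hasLaw_sq_gaussianReal {v : NNReal} (hv : v ≠ 0) :
    HasLaw (fun x => x ^ 2) (gammaMeasure (1 / 2) (1 / (2 * v))) (gaussianReal 0 v) := by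
  have : (0 : ℝ) < v := mod_cast hv.bot_lt
  refine (hasLaw_gammaMeasure_iff_mgf (by norm_num) (by positivity) (by fun_prop)).2 fun t => ?_
  have hs : 1 / (1 - 2 * v * t) = 1 / (2 * v) / (1 / (2 * v) - t) := by field_simp
  rw [mgf_sq_gaussianReal hv, hs]
  split_ifs with h
  · exact Real.sqrt_eq_rpow _
  · exact Real.sqrt_eq_zero_of_nonpos
      (div_nonpos_of_nonneg_of_nonpos (by positivity) (sub_nonpos.2 (not_lt.1 h)))

end GammaLaw

section ComplexGaussian

instance isProbabilityMeasure_complexGaussian : IsProbabilityMeasure complexGaussian :=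
  Measure.isProbabilityMeasure_map (by fun_prop)

instance isProbabilityMeasure_complexGaussianVector (N : ℕ) :
    IsProbabilityMeasure (complexGaussianVector N) := by
  unfold complexGaussianVector
  infer_instance

lemma hasLaw_normSq_complexGaussian :
    HasLaw Complex.normSq (gammaMeasure 1 1) complexGaussian := by
  set ν := gaussianReal 0 (1 / 2)
  have hsq : HasLaw (fun x : ℝ => x ^ 2) (gammaMeasure (1 / 2) 1) ν := by
    simpa [ν] using hasLaw_sq_gaussianReal (v := 1 / 2) one_half_pos.ne'
  have hre : HasLaw (fun x : ℝ × ℝ => x.1 ^ 2) (gammaMeasure (1 / 2) 1) (ν.prod ν) :=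
    hsq.fun_comp measurePreserving_fst.hasLaw
  have him : HasLaw (fun x : ℝ × ℝ => x.2 ^ 2) (gammaMeasure (1 / 2) 1) (ν.prod ν) :=
    hsq.fun_comp measurePreserving_snd.hasLaw
  have hsum := hasLaw_add_gammaMeasure one_half_pos one_half_pos one_pos hre him
    (indepFun_prod (measurable_id.pow_const 2) (measurable_id.pow_const 2))
  rw [add_halves] at hsum
  refine ⟨by fun_prop, ?_⟩
  rw [complexGaussian, Measure.map_map (by fun_prop) (by fun_prop), ← hsum.map_eq]
  exact congrArg (fun f => Measure.map f (ν.prod ν))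
    (funext fun x => Complex.normSq_add_mul_I x.1 x.2)

lemma hasLaw_sum_normSq_complexGaussianVector {N : ℕ} (hN : 0 < N) :
    HasLaw (fun u => ∑ i, Complex.normSq (u i)) (gammaMeasure N 1) (complexGaussianVector N) := by
  have hlaw (i : Fin N) :
      HasLaw (fun u : Fin N → ℂ => Complex.normSq (u i)) (gammaMeasure 1 1)
        (complexGaussianVector N) :=
    hasLaw_normSq_complexGaussian.fun_comp
      (measurePreserving_eval (fun _ => complexGaussian) i).hasLaw
  have hind : iIndepFun (fun i (u : Fin N → ℂ) => Complex.normSq (u i)) (complexGaussianVector N) :=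
    iIndepFun_pi fun _ => by fun_prop
  have : NeZero N := ⟨hN.ne'⟩
  simpa [Finset.sum_fn] using
    hasLaw_sum_gammaMeasure (fun _ => one_pos) one_pos hlaw hind Finset.univ_nonempty

end ComplexGaussian

section MulConvolution

variable {μ ν : Measure ℝ}

lemma ae_pos_prod (hμ : ∀ᵐ x ∂μ, 0 < x) (hν : ∀ᵐ y ∂ν, 0 < y) :
    ∀ᵐ p ∂μ.prod ν, 0 < p.1 ∧ 0 < p.2 :=
  (Measure.quasiMeasurePreserving_fst.ae hμ).and (Measure.quasiMeasurePreserving_snd.ae hν)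

lemma ae_pos_mconv (hμ : ∀ᵐ x ∂μ, 0 < x) (hν : ∀ᵐ y ∂ν, 0 < y) : ∀ᵐ w ∂(μ ∗ₘ ν), 0 < w := by
  rw [Measure.mconv, ae_map_iff (by fun_prop) measurableSet_Ioi]
  filter_upwards [ae_pos_prod hμ hν] with p hp using mul_pos hp.1 hp.2

lemma nullSingletonClass_mconv [SFinite ν] [NullSingletonClass ν] (hμ : ∀ᵐ x ∂μ, x ≠ 0) :
    NullSingletonClass (μ ∗ₘ ν) where
  measure_singleton w := by
    have hm : Measurable fun p : ℝ × ℝ => p.1 * p.2 := by fun_prop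
    rw [Measure.mconv, Measure.map_apply hm (measurableSet_singleton w),
      Measure.measure_prod_null (hm (measurableSet_singleton w))]
    filter_upwards [hμ] with x hx
    refine measure_mono_null (t := {w / x}) (fun y (hy : x * y = w) => ?_) (measure_singleton _)
    rw [Set.mem_singleton_iff, ← hy, mul_div_cancel_left₀ _ hx]

lemma integrable_rpow_mconv (hμ : ∀ᵐ x ∂μ, 0 < x) (hν : ∀ᵐ y ∂ν, 0 < y) {c : ℝ}
    (hμc : Integrable (fun x => x ^ c) μ) (hνc : Integrable (fun y => y ^ c) ν) :
    Integrable (fun w => w ^ c) (μ ∗ₘ ν) := by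
  rw [Measure.mconv, integrable_map_measure (by fun_prop) (by fun_prop)]
  refine (hμc.mul_prod hνc).congr ?_
  filter_upwards [ae_pos_prod hμ hν] with p hp using (Real.mul_rpow hp.1.le hp.2.le).symm

lemma integral_cpow_mconv [SFinite μ] [SFinite ν] (hμ : ∀ᵐ x ∂μ, 0 < x) (hν : ∀ᵐ y ∂ν, 0 < y)
    (s : ℂ) :
    ∫ w, (w : ℂ) ^ s ∂(μ ∗ₘ ν) = (∫ x, (x : ℂ) ^ s ∂μ) * ∫ y, (y : ℂ) ^ s ∂ν := by
  rw [Measure.mconv, integral_map (by fun_prop)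
    (by fun_prop : Measurable fun w : ℝ => (w : ℂ) ^ s).aestronglyMeasurable, ← integral_prod_mul]
  refine integral_congr_ae ?_
  filter_upwards [ae_pos_prod hμ hν] with p hp
  rw [Complex.ofReal_mul, Complex.mul_cpow_ofReal_nonneg hp.1.le hp.2.le]

end MulConvolution

section MellinInversion

variable {E : Type*} [NormedAddCommGroup E] [NormedSpace ℂ E] {σ x : ℝ}

lemma integrable_cpow_smul_of_verticalIntegrable {F : ℂ → E}
    (hF : Complex.VerticalIntegrable F σ) (hx : 0 < x) :
    Integrable fun y : ℝ => (x : ℂ) ^ (-((σ : ℂ) + y * Complex.I)) • F (σ + y * Complex.I) := by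
  have hx0 : (x : ℂ) ≠ 0 := mod_cast hx.ne'
  refine hF.bdd_smul (C := x ^ (-σ))
    (Continuous.const_cpow (by fun_prop) (Or.inl hx0)).aestronglyMeasurable
    (ae_of_all _ fun y => ?_)
  rw [Complex.norm_cpow_eq_rpow_re_of_pos hx]
  simp

lemma mellinInv_eq_of_hasMellin [CompleteSpace E] {f : ℝ → E} {F : ℂ → E} (hx : 0 < x)
    (hf : ∀ s : ℂ, s.re = σ → HasMellin f s (F s)) (hF : Complex.VerticalIntegrable F σ)
    (hfx : ContinuousAt f x) : mellinInv σ F x = f x := by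
  have hmellin (y : ℝ) : mellin f (σ + y * Complex.I) = F (σ + y * Complex.I) :=
    (hf _ (by simp)).2
  rw [← mellinInv_mellin_eq σ f hx (hf σ (Complex.ofReal_re σ)).1
    (by simpa only [Complex.VerticalIntegrable, hmellin] using hF) hfx]
  simp only [mellinInv, hmellin]

end MellinInversion

section MellinCDF

variable {μ : Measure ℝ} {s : ℂ}

lemma continuous_cdf [IsProbabilityMeasure μ] [NullSingletonClass μ] : Continuous (cdf μ) := by
  refine continuous_iff_continuousAt.2 fun x => ?_
  have hx : (cdf μ).measure {x} = 0 := by rw [measure_cdf, measure_singleton]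
  rw [StieltjesFunction.measure_singleton, ENNReal.ofReal_eq_zero, sub_nonpos] at hx
  rw [(monotone_cdf μ).continuousAt_iff_leftLim_eq_rightLim, (cdf μ).rightLim_eq]
  exact le_antisymm ((monotone_cdf μ).leftLim_le le_rfl) hx

lemma hasMellin_indicator_Ici {w : ℝ} (hw : 0 < w) (hs : s.re < 0) :
    HasMellin ((Set.Ici w).indicator fun _ => (1 : ℂ)) s (-(w : ℂ) ^ s / s) := by
  have hsub : Set.Ici w ⊆ Set.Ioi 0 := fun _ hx => hw.trans_le hx
  have hre : (s - 1).re < -1 := by rw [Complex.sub_re, Complex.one_re]; linarith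
  have hind : (fun x : ℝ => (x : ℂ) ^ (s - 1) • (Set.Ici w).indicator (fun _ => (1 : ℂ)) x) =
      (Set.Ici w).indicator fun x => (x : ℂ) ^ (s - 1) := by
    ext x
    simp [Set.indicator_apply]
  rw [HasMellin, MellinConvergent, mellin, hind, IntegrableOn,
    integrable_indicator_iff measurableSet_Ici, IntegrableOn,
    Measure.restrict_restrict measurableSet_Ici, setIntegral_indicator measurableSet_Ici,
    Set.inter_eq_self_of_subset_left hsub, Set.inter_eq_self_of_subset_right hsub, ← IntegrableOn,
    integrableOn_Ici_iff_integrableOn_Ioi, integral_Ici_eq_integral_Ioi,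
    integral_Ioi_cpow_of_lt hre hw, sub_add_cancel]
  exact ⟨integrableOn_Ioi_cpow_of_lt hre hw, rfl⟩

lemma integral_cpow_smul_indicator_Ici [IsProbabilityMeasure μ] (x : ℝ) :
    ∫ w, (x : ℂ) ^ (s - 1) • (Set.Ici w).indicator (fun _ => (1 : ℂ)) x ∂μ =
      (x : ℂ) ^ (s - 1) • (cdf μ x : ℂ) := by
  have hind : (fun w => (Set.Ici w).indicator (fun _ => (1 : ℂ)) x) =
      (Set.Iic x).indicator fun _ => 1 := by
    ext w
    simp [Set.indicator_apply]
  rw [integral_smul, hind, integral_indicator_const _ measurableSet_Iic, cdf_eq_real,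
    Complex.real_smul, mul_one]

lemma integrable_prod_cpow_smul_indicator_Ici [SFinite μ] (hμ : ∀ᵐ w ∂μ, 0 < w) (hs : s.re < 0)
    (hI : Integrable (fun w => w ^ s.re) μ) :
    Integrable (Function.uncurry fun (x w : ℝ) =>
        (x : ℂ) ^ (s - 1) • (Set.Ici w).indicator (fun _ => (1 : ℂ)) x)
      ((volume.restrict (Set.Ioi 0)).prod μ) := by
  have hmeas : Measurable fun p : ℝ × ℝ => (Set.Ici p.2).indicator (fun _ => (1 : ℂ)) p.1 :=
    measurable_const.indicator (measurableSet_le measurable_snd measurable_fst)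
  have hnorm {w : ℝ} (hw : 0 < w) : ∫ x in Set.Ioi (0 : ℝ),
      ‖(x : ℂ) ^ (s - 1) • (Set.Ici w).indicator (fun _ => (1 : ℂ)) x‖ = -w ^ s.re / s.re := by
    have h := (hasMellin_indicator_Ici hw (s := s.re) (by simpa using hs)).2
    rw [← Complex.ofReal_inj, ← integral_complex_ofReal]
    push_cast [Complex.ofReal_cpow hw.le]
    rw [← h, mellin]
    refine setIntegral_congr_fun measurableSet_Ioi fun x (hx : 0 < x) => ?_
    rw [norm_smul, Complex.norm_cpow_eq_rpow_re_of_pos hx, Complex.ofReal_mul,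
      Complex.ofReal_cpow hx.le]
    by_cases hxw : w ≤ x <;> simp [hxw]
  rw [integrable_prod_iff' (by fun_prop)]
  refine ⟨?_, (hI.neg.div_const s.re).congr ?_⟩
  · filter_upwards [hμ] with w hw using (hasMellin_indicator_Ici hw hs).1
  · filter_upwards [hμ] with w hw using (hnorm hw).symm

lemma hasMellin_cdf [IsProbabilityMeasure μ] (hμ : ∀ᵐ w ∂μ, 0 < w) (hs : s.re < 0)
    (hI : Integrable (fun w => w ^ s.re) μ) :
    HasMellin (fun x => (cdf μ x : ℂ)) s (-(∫ w, (w : ℂ) ^ s ∂μ) / s) := by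
  have hK := integrable_prod_cpow_smul_indicator_Ici hμ hs hI
  constructor
  · have hconv := hK.integral_prod_left
    simp only [Function.uncurry_apply_pair, integral_cpow_smul_indicator_Ici] at hconv
    exact hconv
  · have hswap := integral_integral_swap hK
    simp only [integral_cpow_smul_indicator_Ici] at hswap
    rw [mellin, hswap, ← integral_neg, ← integral_div]
    refine integral_congr_ae ?_
    filter_upwards [hμ] with w hw using (hasMellin_indicator_Ici hw hs).2

end MellinCDF

section VerticalIntegrability

variable {σ : ℝ}

lemma norm_Gamma_le_Gamma_re {z : ℂ} (hz : 0 < z.re) : ‖Complex.Gamma z‖ ≤ Real.Gamma z.re := by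
  rw [Complex.Gamma_eq_integral hz, Real.Gamma_eq_integral hz, Complex.GammaIntegral]
  refine (norm_integral_le_integral_norm _).trans_eq ?_
  refine setIntegral_congr_fun measurableSet_Ioi fun x (hx : 0 < x) => ?_
  simp [Complex.norm_cpow_eq_rpow_re_of_pos hx, Complex.norm_exp]

lemma vertical_ne_zero (hσ : σ ≠ 0) (t : ℝ) : (σ : ℂ) + t * Complex.I ≠ 0 := fun h =>
  hσ (by simpa using congrArg Complex.re h)

lemma memLp_two_inv_vertical (hσ : σ ≠ 0) :
    MemLp (fun t : ℝ => ((σ : ℂ) + t * Complex.I)⁻¹) 2 := by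
  have hcont : Continuous fun t : ℝ => ((σ : ℂ) + t * Complex.I)⁻¹ :=
    Continuous.inv₀ (by fun_prop) (vertical_ne_zero hσ)
  rw [memLp_two_iff_integrable_sq_norm hcont.aestronglyMeasurable]
  refine ((integrable_inv_one_add_sq.comp_div hσ).const_mul (σ ^ 2)⁻¹).congr
    (ae_of_all _ fun t => ?_)
  simp only [norm_inv, inv_pow, Complex.sq_norm, Complex.normSq_add_mul_I]
  field_simp

lemma continuous_Gamma_vertical (hσ : 0 < σ) :
    Continuous fun t : ℝ => Complex.Gamma (σ + t * Complex.I) := by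
  refine continuous_iff_continuousAt.2 fun t => ?_
  refine ContinuousAt.comp (g := Complex.Gamma)
    (Complex.continuousAt_Gamma _ fun m hm => ?_) (by fun_prop)
  have hre : σ = -m := by simpa using congrArg Complex.re hm
  linarith [m.cast_nonneg (α := ℝ)]

lemma memLp_two_Gamma_vertical (hσ : 0 < σ) :
    MemLp (fun t : ℝ => Complex.Gamma (σ + t * Complex.I)) 2 := by
  refine (memLp_two_inv_vertical hσ.ne').of_le_mul (c := Real.Gamma (σ + 1))
    (continuous_Gamma_vertical hσ).aestronglyMeasurable (ae_of_all _ fun t => ?_)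
  have hG := Complex.Gamma_add_one _ (vertical_ne_zero hσ.ne' t)
  have hle := norm_Gamma_le_Gamma_re (z := σ + t * Complex.I + 1)
    (by simpa using add_pos hσ one_pos)
  rw [hG, norm_mul] at hle
  have hpos := norm_pos_iff.2 (vertical_ne_zero hσ.ne' t)
  rw [norm_inv, ← div_eq_mul_inv, le_div_iff₀' hpos]
  simpa using hle

end VerticalIntegrability

section GammaProduct

variable {a b σ : ℝ}

/-- The Mellin transform of `Γ(a) Γ(b)` times the distribution function of a product of independent
`Gamma(a, 1)` and `Gamma(b, 1)` variables, on `-min a b < Re s < 0`. -/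
noncomputable def gammaProductMellin (a b s : ℂ) : ℂ :=
  -(Complex.Gamma (a + s) * Complex.Gamma (b + s) / s)

lemma hasMellin_cdf_mconv_gammaMeasure (ha : 0 < a) (hb : 0 < b) {s : ℂ} (hs : s.re < 0)
    (has : 0 < a + s.re) (hbs : 0 < b + s.re) :
    HasMellin (fun x => (Complex.Gamma a * Complex.Gamma b) *
        (cdf (gammaMeasure a 1 ∗ₘ gammaMeasure b 1) x : ℂ)) s
      (gammaProductMellin a b s) := by
  have := isProbabilityMeasure_gammaMeasure ha one_pos
  have := isProbabilityMeasure_gammaMeasure hb one_pos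
  have hposa := ae_pos_gammaMeasure a 1
  have hposb := ae_pos_gammaMeasure b 1
  have hcdf := hasMellin_cdf (ae_pos_mconv hposa hposb) hs (integrable_rpow_mconv hposa hposb
    (integrable_rpow_gammaMeasure ha one_pos has) (integrable_rpow_gammaMeasure hb one_pos hbs))
  rw [integral_cpow_mconv hposa hposb, integral_cpow_gammaMeasure ha one_pos has,
    integral_cpow_gammaMeasure hb one_pos hbs, Complex.ofReal_one, Complex.one_cpow, one_mul,
    one_mul] at hcdf
  have hGa : Complex.Gamma a ≠ 0 := Complex.Gamma_ne_zero_of_re_pos ha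
  have hGb : Complex.Gamma b ≠ 0 := Complex.Gamma_ne_zero_of_re_pos hb
  have hscale : gammaProductMellin a b s = (Complex.Gamma a * Complex.Gamma b) •
      mellin (fun x => (cdf (gammaMeasure a 1 ∗ₘ gammaMeasure b 1) x : ℂ)) s := by
    rw [hcdf.2, gammaProductMellin, smul_eq_mul]
    field_simp
  rw [hscale]
  exact hasMellin_const_smul hcdf.1 (Complex.Gamma a * Complex.Gamma b)

lemma verticalIntegrable_gammaProductMellin (hσ : σ ≠ 0) (ha : 0 < a + σ) (hb : 0 < b + σ) :
    Complex.VerticalIntegrable (gammaProductMellin a b) σ := by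
  have hprod := (memLp_two_Gamma_vertical ha).integrable_mul (memLp_two_Gamma_vertical hb)
  have hinv := memLp_two_inv_vertical hσ
  have hbound (t : ℝ) : ‖((σ : ℂ) + t * Complex.I)⁻¹‖ ≤ |σ|⁻¹ := by
    rw [norm_inv]
    refine inv_anti₀ (abs_pos.2 hσ) ?_
    simpa using Complex.abs_re_le_norm (σ + t * Complex.I)
  refine (hprod.bdd_mul hinv.aestronglyMeasurable (ae_of_all _ hbound)).neg.congr
    (ae_of_all _ fun t => ?_)
  simp only [gammaProductMellin, Pi.mul_apply, Pi.neg_apply, Complex.ofReal_add]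
  ring_nf

end GammaProduct

section MeijerG

variable {a b c x : ℝ}

lemma meijerGSeparates_two_one_iff :
    MeijerGSeparates 2 1 ![(1 : ℂ)] ![(a : ℂ), (b : ℂ), 0] c ↔ 0 < c ∧ c < a ∧ c < b := by
  refine ⟨fun h => ⟨?_, ?_, ?_⟩, fun ⟨h0, ha, hb⟩ => ⟨fun j hj k => ?_, fun j _ k => ?_⟩⟩
  · simpa using h.2 0 (by simp) 0
  · simpa using h.1 0 (by simp) 0
  · simpa using h.1 1 (by simp) 0
  · have hk : (0 : ℝ) ≤ k := k.cast_nonneg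
    fin_cases j
    · simpa using ha.trans_le (le_add_of_nonneg_right hk)
    · simpa using hb.trans_le (le_add_of_nonneg_right hk)
    · simp at hj
  · have hk : (0 : ℝ) ≤ k := k.cast_nonneg
    fin_cases j
    simpa using (neg_nonpos.2 hk).trans_lt h0

lemma exists_meijerGSeparates_two_one (ha : 0 < a) (hb : 0 < b) :
    ∃ c : ℝ, MeijerGSeparates 2 1 ![(1 : ℂ)] ![(a : ℂ), (b : ℂ), 0] c := by
  obtain ⟨c, h0, hc⟩ := exists_between (lt_min ha hb)
  exact ⟨c, meijerGSeparates_two_one_iff.2 ⟨h0, lt_min_iff.1 hc⟩⟩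

lemma meijerGIntegrand_two_one_neg (a b z : ℂ) {s : ℂ} (hs : s.re < 0) :
    meijerGIntegrand 2 1 ![(1 : ℂ)] ![a, b, 0] z (-s) = z ^ (-s) • gammaProductMellin a b s := by
  have hs0 : s ≠ 0 := fun h => by simp [h] at hs
  have hG : Complex.Gamma (-s) ≠ 0 := Complex.Gamma_ne_zero_of_re_pos (by simpa using hs)
  have hratio : Complex.Gamma (-s) / Complex.Gamma (-s + 1) = -1 / s := by
    rw [Complex.Gamma_add_one _ (neg_ne_zero.2 hs0)]
    field_simp
  calc meijerGIntegrand 2 1 ![(1 : ℂ)] ![a, b, 0] z (-s)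
      = Complex.Gamma (a + s) * Complex.Gamma (b + s) * (Complex.Gamma (1 + -s))⁻¹ *
          Complex.Gamma (-s) * z ^ (-s) := by
        simp [meijerGIntegrand, Fin.prod_univ_three]
    _ = z ^ (-s) * (Complex.Gamma (a + s) * Complex.Gamma (b + s) *
          (Complex.Gamma (-s) / Complex.Gamma (-s + 1))) := by
        ring_nf
    _ = z ^ (-s) • gammaProductMellin a b s := by
        rw [hratio, gammaProductMellin, smul_eq_mul]
        ring

lemma meijerGIntegrand_two_one_vertical (a b z : ℂ) (hc : 0 < c) (t : ℝ) :
    meijerGIntegrand 2 1 ![(1 : ℂ)] ![a, b, 0] z (c + t * Complex.I) =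
      z ^ (-(((-c : ℝ) : ℂ) + ((-t : ℝ) : ℂ) * Complex.I)) •
        gammaProductMellin a b (((-c : ℝ) : ℂ) + ((-t : ℝ) : ℂ) * Complex.I) := by
  rw [← meijerGIntegrand_two_one_neg a b z (by simpa using hc)]
  push_cast
  ring_nf

lemma meijerGLine_two_one_eq_mellinInv (a b : ℂ) (hc : 0 < c) (x : ℝ) :
    meijerGLine 2 1 ![(1 : ℂ)] ![a, b, 0] c x = mellinInv (-c) (gammaProductMellin a b) x := by
  simp only [meijerGLine, meijerGIntegrand_two_one_vertical a b x hc]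
  rw [integral_neg_eq_self (fun t : ℝ => (x : ℂ) ^ (-(((-c : ℝ) : ℂ) + (t : ℂ) * Complex.I)) •
    gammaProductMellin a b (((-c : ℝ) : ℂ) + (t : ℂ) * Complex.I)), mellinInv, one_div,
    Complex.real_smul]
  push_cast
  rfl

lemma integrable_meijerGIntegrand_two_one (hx : 0 < x)
    (hc : MeijerGSeparates 2 1 ![(1 : ℂ)] ![(a : ℂ), (b : ℂ), 0] c) :
    Integrable fun t : ℝ =>
      meijerGIntegrand 2 1 ![(1 : ℂ)] ![(a : ℂ), (b : ℂ), 0] x (c + t * Complex.I) := by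
  obtain ⟨h0, hca, hcb⟩ := meijerGSeparates_two_one_iff.1 hc
  simp only [meijerGIntegrand_two_one_vertical _ _ _ h0]
  exact (integrable_cpow_smul_of_verticalIntegrable
    (verticalIntegrable_gammaProductMellin (by linarith) (by linarith) (by linarith)) hx).comp_neg

lemma meijerGLine_two_one_eq_cdf (hx : 0 < x)
    (hc : MeijerGSeparates 2 1 ![(1 : ℂ)] ![(a : ℂ), (b : ℂ), 0] c) :
    meijerGLine 2 1 ![(1 : ℂ)] ![(a : ℂ), (b : ℂ), 0] c x =
      Complex.Gamma a * Complex.Gamma b * cdf (gammaMeasure a 1 ∗ₘ gammaMeasure b 1) x := by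
  obtain ⟨h0, hca, hcb⟩ := meijerGSeparates_two_one_iff.1 hc
  have ha := h0.trans hca
  have hb := h0.trans hcb
  have := isProbabilityMeasure_gammaMeasure ha one_pos
  have := isProbabilityMeasure_gammaMeasure hb one_pos
  have := nullSingletonClass_mconv (ν := gammaMeasure b 1)
    ((ae_pos_gammaMeasure a 1).mono fun _ h => h.ne')
  have hcont := continuous_cdf (μ := gammaMeasure a 1 ∗ₘ gammaMeasure b 1)
  rw [meijerGLine_two_one_eq_mellinInv _ _ h0]
  exact mellinInv_eq_of_hasMellin hx
    (fun s hs => hasMellin_cdf_mconv_gammaMeasure ha hb (by linarith) (by linarith) (by linarith))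
    (verticalIntegrable_gammaProductMellin (by linarith) (by linarith) (by linarith)) (by fun_prop)

lemma meijerG_two_one (ha : 0 < a) (hb : 0 < b) (hx : 0 < x) :
    meijerG 2 1 ![(1 : ℂ)] ![(a : ℂ), (b : ℂ), 0] x =
      Complex.Gamma a * Complex.Gamma b * cdf (gammaMeasure a 1 ∗ₘ gammaMeasure b 1) x := by
  have h := exists_meijerGSeparates_two_one ha hb
  rw [meijerG, dif_pos h, meijerGLine_two_one_eq_cdf hx h.choose_spec]

lemma meijerGWellDefined_two_one (ha : 0 < a) (hb : 0 < b) (hx : 0 < x) :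
    MeijerGWellDefined 2 1 ![(1 : ℂ)] ![(a : ℂ), (b : ℂ), 0] x :=
  ⟨exists_meijerGSeparates_two_one ha hb, fun _ hc => ⟨integrable_meijerGIntegrand_two_one hx hc,
    (meijerGLine_two_one_eq_cdf hx hc).trans (meijerG_two_one ha hb hx).symm⟩⟩

end MeijerG

section Keyhole

variable {NR NT : ℕ}

lemma star_dotProduct_self_eq_sum_normSq {ι : Type*} [Fintype ι] (u : ι → ℂ) :
    star u ⬝ᵥ u = ((∑ i, Complex.normSq (u i) : ℝ) : ℂ) := by
  push_cast
  exact Finset.sum_congr rfl fun i _ => (Complex.normSq_eq_conj_mul_self).symm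

lemma det_one_add_smul_keyholeChannel (g : ℂ) (u : Fin NR → ℂ) (v : Fin NT → ℂ) :
    (1 + g • (keyholeChannel u v * (keyholeChannel u v).conjTranspose)).det =
      1 + g * (((∑ i, Complex.normSq (u i)) * ∑ j, Complex.normSq (v j) : ℝ) : ℂ) := by
  rw [keyholeChannel, Matrix.conjTranspose_vecMulVec, star_star, Matrix.vecMulVec_mul_vecMulVec,
    ← Matrix.vecMulVec_smul, Matrix.vecMulVec_eq Unit,
    Matrix.det_one_add_replicateCol_mul_replicateRow, smul_dotProduct, smul_dotProduct,
    star_dotProduct_self_eq_sum_normSq, star_dotProduct_self_eq_sum_normSq, smul_eq_mul,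
    smul_eq_mul, Complex.ofReal_mul, mul_comm (Complex.ofReal _)]

lemma mutualInfo_keyholeChannel (γ : ℝ) (u : Fin NR → ℂ) (v : Fin NT → ℂ) :
    mutualInfo γ (keyholeChannel u v) =
      Real.logb 2 (1 + γ / NT * ((∑ i, Complex.normSq (u i)) * ∑ j, Complex.normSq (v j))) := by
  rw [mutualInfo, det_one_add_smul_keyholeChannel]
  norm_cast

lemma mutualInfo_keyholeChannel_lt_iff (hNT : 0 < NT) {γ R : ℝ} (hγ : 0 < γ)
    (u : Fin NR → ℂ) (v : Fin NT → ℂ) :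
    mutualInfo γ (keyholeChannel u v) < R ↔
      (∑ i, Complex.normSq (u i)) * ∑ j, Complex.normSq (v j) < NT / γ * ((2 : ℝ) ^ R - 1) := by
  have : (0 : ℝ) < NT := mod_cast hNT
  have hu : 0 ≤ ∑ i, Complex.normSq (u i) := Finset.sum_nonneg fun i _ => Complex.normSq_nonneg _
  have hv : 0 ≤ ∑ j, Complex.normSq (v j) := Finset.sum_nonneg fun j _ => Complex.normSq_nonneg _
  rw [mutualInfo_keyholeChannel, Real.logb_lt_iff_lt_rpow one_lt_two (by positivity),
    ← lt_sub_iff_add_lt', ← lt_div_iff₀' (by positivity), div_div_eq_mul_div, div_mul_eq_mul_div,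
    mul_comm (_ - 1)]

lemma measurable_mutualInfo (γ : ℝ) :
    Measurable (mutualInfo γ : Matrix (Fin NR) (Fin NT) ℂ → ℝ) := by
  have : ∀ i j, Measurable fun H : Matrix (Fin NR) (Fin NT) ℂ => H i j := fun i j =>
    (measurable_pi_apply j).comp (measurable_pi_apply i)
  have hdet : Measurable fun H : Matrix (Fin NR) (Fin NT) ℂ =>
      (1 + ((γ / NT : ℝ) : ℂ) • (H * H.conjTranspose)).det := by
    simp only [Matrix.det_apply, Matrix.add_apply, Matrix.smul_apply, Matrix.mul_apply,
      Matrix.conjTranspose_apply]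
    fun_prop
  exact (Real.measurable_log.comp (Complex.measurable_re.comp hdet)).div_const _

variable {Ω : Type*} [MeasurableSpace Ω] {P : Measure Ω}

lemma outageProbability_eq_prod {K : ℕ} [NeZero K] (γ : Fin K → ℝ)
    {H : Fin K → Ω → Matrix (Fin NR) (Fin NT) ℂ} (hH : iIndepFun H P) (R : ℝ) :
    outageProbability P γ H R = ∏ k, P.real {ω | mutualInfo (γ k) (H k ω) < R} := by
  have hset : {ω | typeIMutualInfo γ (fun k => H k ω) < R} =
      ⋂ k, {ω | mutualInfo (γ k) (H k ω) < R} := by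
    ext ω
    simp [typeIMutualInfo]
  simp only [outageProbability, hset, measureReal_def, ← ENNReal.toReal_prod]
  exact congrArg ENNReal.toReal (hH.meas_iInter fun k =>
    ⟨{A | mutualInfo (γ k) A < R}, measurableSet_lt (measurable_mutualInfo _) measurable_const,
      rfl⟩)

variable {u : Ω → Fin NR → ℂ} {v : Ω → Fin NT → ℂ}

lemma hasLaw_sum_normSq_mul_sum_normSq (hNR : 0 < NR) (hNT : 0 < NT)
    (hu : HasLaw u (complexGaussianVector NR) P) (hv : HasLaw v (complexGaussianVector NT) P)
    (huv : IndepFun u v P) :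
    HasLaw (fun ω => (∑ i, Complex.normSq (u ω i)) * ∑ j, Complex.normSq (v ω j))
      (gammaMeasure NT 1 ∗ₘ gammaMeasure NR 1) P := by
  have hmeas (N : ℕ) : Measurable fun w : Fin N → ℂ => ∑ i, Complex.normSq (w i) := by fun_prop
  have := isProbabilityMeasure_gammaMeasure (a := NR) (r := 1) (mod_cast hNR) one_pos
  have := isProbabilityMeasure_gammaMeasure (a := NT) (r := 1) (mod_cast hNT) one_pos
  rw [Measure.mconv_comm]
  exact (huv.comp (hmeas NR) (hmeas NT)).hasLaw_fun_mul
    ((hasLaw_sum_normSq_complexGaussianVector hNR).comp hu)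
    ((hasLaw_sum_normSq_complexGaussianVector hNT).comp hv)

lemma measureReal_mutualInfo_keyholeChannel_lt (hNR : 0 < NR) (hNT : 0 < NT) {γ : ℝ} (hγ : 0 < γ)
    (hu : HasLaw u (complexGaussianVector NR) P) (hv : HasLaw v (complexGaussianVector NT) P)
    (huv : IndepFun u v P) (R : ℝ) :
    P.real {ω | mutualInfo γ (keyholeChannel (u ω) (v ω)) < R} =
      cdf (gammaMeasure NT 1 ∗ₘ gammaMeasure NR 1) (NT / γ * ((2 : ℝ) ^ R - 1)) := by
  have := isProbabilityMeasure_gammaMeasure (a := NR) (r := 1) (mod_cast hNR) one_pos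
  have := isProbabilityMeasure_gammaMeasure (a := NT) (r := 1) (mod_cast hNT) one_pos
  have := nullSingletonClass_mconv (ν := gammaMeasure NR 1)
    ((ae_pos_gammaMeasure NT 1).mono fun _ h => h.ne')
  simp only [mutualInfo_keyholeChannel_lt_iff hNT hγ]
  rw [(hasLaw_sum_normSq_mul_sum_normSq hNR hNT hu hv huv).measureReal_eq measurableSet_Iio,
    cdf_eq_real]
  exact measureReal_congr Iio_ae_eq_Iic

end Keyhole

theorem mainTheorem1 {Ω : Type*} [MeasurableSpace Ω] (P : Measure Ω) [IsProbabilityMeasure P]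
    (K NT NR : ℕ) [NeZero K] (hNT : 0 < NT) (hNR : 0 < NR)
    (γ : Fin K → ℝ) (hγ : ∀ k, 0 < γ k) (R : ℝ) (hR : 0 < R)
    (u : Fin K → Ω → Fin NR → ℂ) (v : Fin K → Ω → Fin NT → ℂ)
    (hu : ∀ k, HasLaw (u k) (complexGaussianVector NR) P)
    (hv : ∀ k, HasLaw (v k) (complexGaussianVector NT) P)
    (huv : ∀ k, IndepFun (u k) (v k) P)
    (hH : iIndepFun (fun k ω => keyholeChannel (u k ω) (v k ω)) P) :
    (∀ k, MeijerGWellDefined 2 1 ![(1 : ℂ)] ![(NT : ℂ), (NR : ℂ), 0]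
      ((NT / γ k * ((2 : ℝ) ^ R - 1) : ℝ) : ℂ)) ∧
    (outageProbability P γ (fun k ω => keyholeChannel (u k ω) (v k ω)) R : ℂ) =
      1 / (Complex.Gamma NT * Complex.Gamma NR) ^ K *
        ∏ k, meijerG 2 1 ![(1 : ℂ)] ![(NT : ℂ), (NR : ℂ), 0]
          ((NT / γ k * ((2 : ℝ) ^ R - 1) : ℝ) : ℂ) := by
  have hNT' : (0 : ℝ) < NT := mod_cast hNT
  have hNR' : (0 : ℝ) < NR := mod_cast hNR
  have hx (k) : 0 < NT / γ k * ((2 : ℝ) ^ R - 1) :=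
    mul_pos (div_pos hNT' (hγ k)) (sub_pos.2 (Real.one_lt_rpow one_lt_two hR))
  rw [← Complex.ofReal_natCast NT, ← Complex.ofReal_natCast NR]
  refine ⟨fun k => meijerGWellDefined_two_one hNT' hNR' (hx k), ?_⟩
  have hGT : Complex.Gamma (NT : ℝ) ≠ 0 := Complex.Gamma_ne_zero_of_re_pos hNT'
  have hGR : Complex.Gamma (NR : ℝ) ≠ 0 := Complex.Gamma_ne_zero_of_re_pos hNR'
  rw [outageProbability_eq_prod γ hH]
  simp only [measureReal_mutualInfo_keyholeChannel_lt hNR hNT (hγ _) (hu _) (hv _) (huv _),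
    meijerG_two_one hNT' hNR' (hx _), Complex.ofReal_prod, Finset.prod_mul_distrib,
    Finset.prod_const, Finset.card_univ, Fintype.card_fin, mul_pow]
  field_simp
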